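/- Fix an integer $n\ge 0$ and a stage game with players $1,\dots,n$, finite nonempty action sets $A_i$, $A=\prod_i A_i$, and payoff function $g=(g_1,\dots,g_n):A\to\mathbb R^n$, extended to mixed actions by expectation. Let $F=\mathrm{co}(g(A))$. Let $\mathcal A^{\mathrm{MI}}$ be the set of profiles $\alpha=(\alpha_1,\dots,\alpha_n)\in\prod_i\Delta A_i$ of independent mixed actions such that $g_i(a_i,\alpha_{-i})=g_i(\alpha)$ for every $i$ and every $a_i$ in the support of $\alpha_i$, and put $$\underline v_i^{\mathrm{MI}}=\min_{\alpha\in\mathcal A^{\mathrm{MI}}}\max_{a_i\in A_i}g_i(a_i,\alpha_{-i}),\qquad F^{\mathrm{MI}}=\{v\in F: v_i>\underline v_i^{\mathrm{MI}}\ \text{for all } i\}.$$ The stage game is infinitely repeated under perfect monitoring, without a public randomization device; a behavioral strategy of player $i$ maps finite histories of action profiles to $\Delta A_i$, and $U_i(\sigma;\delta_i)$ is the expectation of $(1-\delta_i)\sum_{t\ge1}\delta_i^{t-1}g_i(a^{(t)})$ under the strategy profile $\sigma$. A strategy profile $\sigma$ is a Blackwell SPNE if there is $\underline\delta\in[0,1)$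 such that $\sigma$ is a subgame-perfect Nash equilibrium of the repeated game for every vector of discount factors $\boldsymbol\delta=(\delta_1,\dots,\delta_n)\in[\underline\delta,1)^n$. A vector $v\in\mathbb R^n$ is a limit Blackwell payoff if there is a Blackwell SPNE $\sigma$ with $U(\sigma;\boldsymbol\delta)=(U_i(\sigma;\delta_i))_{i}\to v$ as $\boldsymbol\delta\to(1,\dots,1)$ in $[0,1)^n$. Suppose that the dimension of $F$ is $n$. Then every $v\in F^{\mathrm{MI}}$ is a limit Blackwell payoff. Conversely, if $F^{\mathrm{MI}}$ is nonempty, then every limit Blackwell payoff lies in the closure of $F^{\mathrm{MI}}$. -/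

import Mathlib

open Set Filter Topology

noncomputable section

namespace RepeatedGame

variable {n : ℕ} {A : Fin n → Type*}

/-- Pure action profiles `a = (a₁, …, aₙ)`; player `i` has the action set `A i`. -/
abbrev Profile (A : Fin n → Type*) := ∀ i, A i

/-- Finite histories of pure action profiles, in chronological order (oldest profile first);
the empty list is the initial history. -/
abbrev History (A : Fin n → Type*) := List (Profile A)

variable [∀ i, Fintype (A i)]

/-- Mixed actions of player `i`: probability vectors on `A i`. -/
abbrev MixedAction (A : Fin n → Type*) [∀ i, Fintype (A i)] (i : Fin n) :=
  stdSimplex ℝ (A i)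

/-- Profiles of independent mixed actions. -/
abbrev MixedProfile (A : Fin n → Type*) [∀ i, Fintype (A i)] := ∀ i, MixedAction A i

/-- Behavioral strategies of player `i`. -/
abbrev Strategy (A : Fin n → Type*) [∀ i, Fintype (A i)] (i : Fin n) :=
  History A → MixedAction A i

/-- Profiles of behavioral strategies. -/
abbrev StrategyProfile (A : Fin n → Type*) [∀ i, Fintype (A i)] := ∀ i, Strategy A i

/-- The pure action `a`, seen as a mixed action. -/
def pureAction [∀ i, DecidableEq (A i)] {i : Fin n} (a : A i) : MixedAction A i :=
  ⟨Pi.single a 1, single_mem_stdSimplex ℝ a⟩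

/-- Probability that the independent mixed profile `α` produces the pure profile `a`. -/
def profileProb (α : MixedProfile A) (a : Profile A) : ℝ := ∏ i, (α i : A i → ℝ) (a i)

/-- Expected stage reward of player `i` under the mixed profile `α`. -/
def reward (g : Profile A → Fin n → ℝ) (i : Fin n) (α : MixedProfile A) : ℝ :=
  ∑ a, profileProb α a * g a i

/-- Expected stage reward `g i (a, α₋ᵢ)` of player `i` when `i` plays `a` and the others play
according to `α`. -/
def devReward [∀ i, DecidableEq (A i)] (g : Profile A → Fin n → ℝ) (i : Fin n) (a : A i)
    (α : MixedProfile A) : ℝ :=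
  reward g i (Function.update α i (pureAction a))

/-- Feasible payoffs: the convex hull of the pure payoff vectors. -/
def feasible (g : Profile A → Fin n → ℝ) : Set (Fin n → ℝ) := convexHull ℝ (range g)

/-- The dimension of a set of payoff vectors (the dimension of its affine hull). -/
def dimension (S : Set (Fin n → ℝ)) : ℕ := Module.finrank ℝ (vectorSpan ℝ S)

/-- Myopically indifferent mixed profiles: every action in the support of `α i` gives player `i`
the same reward. -/
def myopicIndiff [∀ i, DecidableEq (A i)] (g : Profile A → Fin n → ℝ) : Set (MixedProfile A) :=
  {α | ∀ i, ∀ a : A i, (α i : A i → ℝ) a ≠ 0 → devReward g i a α = reward g i α}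

/-- The MI-minmax payoff of player `i`. The set `myopicIndiff g` is compact (and nonempty, as it
contains the pure profiles), so the infimum is a minimum; the supremum is over a finite set. -/
def miMinmax [∀ i, DecidableEq (A i)] (g : Profile A → Fin n → ℝ) (i : Fin n) : ℝ :=
  sInf ((fun α : MixedProfile A => ⨆ a : A i, devReward g i a α) '' myopicIndiff g)

/-- Feasible payoff vectors that give every player strictly more than the MI-minmax payoff. -/
def feasibleMI [∀ i, DecidableEq (A i)] (g : Profile A → Fin n → ℝ) : Set (Fin n → ℝ) :=
  {v | v ∈ feasible g ∧ ∀ i, miMinmax g i < v i}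

/-- The continuation of the strategy profile `σ` after the history `h`. -/
def continuation (σ : StrategyProfile A) (h : History A) : StrategyProfile A :=
  fun i k => σ i (h ++ k)

/-- Probability that play under `σ` starts with the given finite history. -/
def historyProb : StrategyProfile A → History A → ℝ
  | _, [] => 1
  | σ, a :: h => profileProb (fun i => σ i []) a * historyProb (continuation σ [a]) h

/-- Expected stage reward of player `i` in the round that follows `t` earlier rounds, under `σ`:
the expectation of `g i` at the last profile of the random history of length `t + 1`. -/
def expectedReward (g : Profile A → Fin n → ℝ) (σ : StrategyProfile A) (i : Fin n) (t : ℕ) : ℝ :=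
  ∑ h : Fin (t + 1) → Profile A, historyProb σ (List.ofFn h) * g (h (Fin.last t)) i

/-- Expected average discounted payoff of player `i` with discount factor `d`. For
`0 ≤ d < 1` the series converges absolutely, since expected rewards are bounded. -/
def payoff (g : Profile A → Fin n → ℝ) (σ : StrategyProfile A) (i : Fin n) (d : ℝ) : ℝ :=
  (1 - d) * ∑' t : ℕ, d ^ t * expectedReward g σ i t

/-- The payoff vector at the vector of discount factors `δ`. -/
def payoffVector (g : Profile A → Fin n → ℝ) (σ : StrategyProfile A) (δ : Fin n → ℝ) :
    Fin n → ℝ :=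
  fun i => payoff g σ i (δ i)

/-- Nash equilibrium of the repeated game with discount factors `δ`. -/
def IsNash (g : Profile A → Fin n → ℝ) (δ : Fin n → ℝ) (σ : StrategyProfile A) : Prop :=
  ∀ i, ∀ τ : Strategy A i, payoff g (Function.update σ i τ) i (δ i) ≤ payoff g σ i (δ i)

/-- Subgame-perfect Nash equilibrium: the continuation after every history is Nash. -/
def IsSPNE (g : Profile A → Fin n → ℝ) (δ : Fin n → ℝ) (σ : StrategyProfile A) : Prop :=
  ∀ h : History A, IsNash g δ (continuation σ h)

/-- `σ` is a Blackwell SPNE above `d₀`: one profile that is an SPNE for all vectors of (possibly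
distinct) discount factors in `[d₀, 1)`. -/
def IsBlackwellSPNEAbove (g : Profile A → Fin n → ℝ) (σ : StrategyProfile A) (d₀ : ℝ) : Prop :=
  ∀ δ : Fin n → ℝ, (∀ i, δ i ∈ Ico d₀ 1) → IsSPNE g δ σ

/-- Blackwell SPNE: Blackwell SPNE above some `d₀ ∈ [0, 1)`. -/
def IsBlackwellSPNE (g : Profile A → Fin n → ℝ) (σ : StrategyProfile A) : Prop :=
  ∃ d₀ ∈ Ico (0 : ℝ) 1, IsBlackwellSPNEAbove g σ d₀

/-- `v` is a limit Blackwell payoff: the payoffs of a single Blackwell SPNE converge to `v` as the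
vector of discount factors in `[0, 1)ⁿ` tends to `(1, …, 1)`. -/
def IsLimitBlackwellPayoff (g : Profile A → Fin n → ℝ) (v : Fin n → ℝ) : Prop :=
  ∃ σ : StrategyProfile A, IsBlackwellSPNE g σ ∧
    Tendsto (payoffVector g σ) (𝓝[{δ | ∀ i, δ i ∈ Ico (0 : ℝ) 1}] (fun _ => 1)) (𝓝 v)

end RepeatedGame

end

/-! Necessity. If play is Nash for every large common discount factor, an action in the support of
the current mixture and the mixture itself yield the same payoff for a whole interval of discount
factors. The difference is a power series in `d` vanishing on that interval, so its constant term,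
the difference of current stage rewards, is zero (`coeff_zero_of_discAvg_eq_zero`). Hence a
Blackwell SPNE prescribes a myopically indifferent profile after every history. Against such play a
myopic best reply earns at least `miMinmax` in every round, so limit payoffs cannot lie below it.

Sufficiency. Play follows a deterministic path of myopically indifferent profiles. Any player who
leaves the support starts a personal path: a block of near-minmaxing rounds, then a pure sequence
averaging to a punishment payoff `w i`. Moves inside the support change neither the mover's expected
stage reward nor the path, so mixing needs no compensation. Full dimension makes `w i` worse for
player `i` than the target and than every `w j` (`exists_punishment_payoffs`).

One profile serves all discount factors because the sequences have bounded discrepancy: all their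
discounted tails are within O(1 - d) of the target (`abs_discAvg_tail_sub_le`). Where the limits
differ, incentives are strict; on the own punishment path they hold at order 1 - d, by the length of
the block (`eventually_deviation_le`). -/

namespace RepeatedGame

/-! ### Discounted averages of bounded sequences -/

/-- The normalised discounted sum `(1 - d) ∑ dᵗ xₜ`. -/
noncomputable def discAvg (d : ℝ) (x : ℕ → ℝ) : ℝ := (1 - d) * ∑' t : ℕ, d ^ t * x t

lemma summable_disc {d B : ℝ} (h0 : 0 ≤ d) (h1 : d < 1) {x : ℕ → ℝ} (hx : ∀ t, |x t| ≤ B) :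
    Summable fun t : ℕ => d ^ t * x t := by
  refine Summable.of_norm_bounded ((summable_geometric_of_lt_one h0 h1).mul_right B) fun t => ?_
  rw [Real.norm_eq_abs, abs_mul, abs_of_nonneg (pow_nonneg h0 t)]
  exact mul_le_mul_of_nonneg_left (hx t) (pow_nonneg h0 t)

lemma discAvg_const {d : ℝ} (h0 : 0 ≤ d) (h1 : d < 1) (c : ℝ) : discAvg d (fun _ => c) = c := by
  rw [discAvg, tsum_mul_right, tsum_geometric_of_lt_one h0 h1, ← mul_assoc,
    mul_inv_cancel₀ (by linarith), one_mul]

lemma discAvg_mono {d B B' : ℝ} (h0 : 0 ≤ d) (h1 : d < 1) {x y : ℕ → ℝ} (hx : ∀ t, |x t| ≤ B)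
    (hy : ∀ t, |y t| ≤ B') (h : ∀ t, x t ≤ y t) : discAvg d x ≤ discAvg d y := by
  refine mul_le_mul_of_nonneg_left ?_ (by linarith)
  exact (summable_disc h0 h1 hx).tsum_le_tsum
    (fun t => mul_le_mul_of_nonneg_left (h t) (pow_nonneg h0 t)) (summable_disc h0 h1 hy)

lemma discAvg_sub {d B B' : ℝ} (h0 : 0 ≤ d) (h1 : d < 1) {x y : ℕ → ℝ} (hx : ∀ t, |x t| ≤ B)
    (hy : ∀ t, |y t| ≤ B') : discAvg d (fun t => x t - y t) = discAvg d x - discAvg d y := by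
  simp only [discAvg, mul_sub]
  rw [(summable_disc h0 h1 hx).tsum_sub (summable_disc h0 h1 hy), mul_sub]

lemma abs_discAvg_le {d B : ℝ} (h0 : 0 ≤ d) (h1 : d < 1) {x : ℕ → ℝ} (hx : ∀ t, |x t| ≤ B) :
    |discAvg d x| ≤ B := by
  have hc : ∀ c : ℝ, ∀ t : ℕ, |(fun _ : ℕ => c) t| ≤ |c| := fun c _ => le_rfl
  rw [abs_le]
  constructor
  · rw [← discAvg_const h0 h1 (-B)]
    exact discAvg_mono h0 h1 (hc _) hx fun t => (abs_le.1 (hx t)).1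
  · calc _ ≤ discAvg d (fun _ => B) := discAvg_mono h0 h1 hx (hc _) fun t => (abs_le.1 (hx t)).2
      _ = B := discAvg_const h0 h1 B

lemma discAvg_succ {d B : ℝ} (h0 : 0 ≤ d) (h1 : d < 1) {x : ℕ → ℝ} (hx : ∀ t, |x t| ≤ B) :
    discAvg d x = (1 - d) * x 0 + d * discAvg d (fun t => x (t + 1)) := by
  rw [discAvg, (summable_disc h0 h1 hx).tsum_eq_zero_add, discAvg]
  have : ∀ t : ℕ, d ^ (t + 1) * x (t + 1) = d * (d ^ t * x (t + 1)) := fun t => by ring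
  simp only [this, tsum_mul_left]
  ring

/-- Bounded partial sums make discounted averages of order `1 - d`. -/
lemma abs_discAvg_le_of_partialSums {d C : ℝ} (h0 : 0 ≤ d) (h1 : d < 1) {x : ℕ → ℝ}
    (hC : ∀ T, |∑ t ∈ Finset.range T, x t| ≤ C) :
    |discAvg d x| ≤ C * (1 - d) := by
  set S : ℕ → ℝ := fun T => ∑ t ∈ Finset.range T, x t
  -- Summation by parts: `x` is the difference of the shifted partial sums and the partial sums `S`,
  -- and `S 0 = 0`, which leaves a factor `1 - d`.
  have e1 : discAvg d S = d * discAvg d (fun t => S (t + 1)) := by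
    rw [discAvg_succ h0 h1 hC]; simp [S]
  have e2 : discAvg d x = discAvg d (fun t => S (t + 1)) - discAvg d S := by
    rw [← discAvg_sub h0 h1 (fun t => hC (t + 1)) hC]
    congr 1; ext t; simp [Finset.sum_range_succ]
  have e3 : discAvg d x = discAvg d (fun t => S (t + 1)) * (1 - d) := by rw [e2, e1]; ring
  rw [e3, abs_mul, abs_of_pos (by linarith : 0 < 1 - d)]
  exact mul_le_mul_of_nonneg_right (abs_discAvg_le h0 h1 fun t => hC (t + 1)) (by linarith)

/-- Bounded discrepancy controls all discounted tail averages at once. -/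
lemma abs_discAvg_tail_sub_le {d B C m : ℝ} (h0 : 0 ≤ d) (h1 : d < 1) {x : ℕ → ℝ}
    (hx : ∀ t, |x t| ≤ B) (hC : ∀ T, |∑ t ∈ Finset.range T, (x t - m)| ≤ C) (s : ℕ) :
    |discAvg d (fun t => x (s + t)) - m| ≤ 2 * C * (1 - d) := by
  have h : discAvg d (fun t => x (s + t)) - m = discAvg d (fun t => x (s + t) - m) := by
    rw [discAvg_sub h0 h1 (fun t => hx (s + t)) (y := fun _ => m) (fun _ => le_rfl),
      discAvg_const h0 h1]
  rw [h]
  refine abs_discAvg_le_of_partialSums h0 h1 fun T => ?_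
  -- A block of terms is a difference of two initial partial sums, hence the factor 2.
  have := Finset.sum_range_add (fun t => x t - m) s T
  rw [eq_sub_of_add_eq' this.symm]
  refine (abs_sub _ _).trans ?_
  linarith [hC (s + T), hC s]

/-- A discounted average that starts with `N` rounds at the constant `p`. -/
lemma discAvg_eq_of_prefix {d B p : ℝ} (h0 : 0 ≤ d) (h1 : d < 1) (N : ℕ) {x : ℕ → ℝ}
    (hx : ∀ t, |x t| ≤ B) (hp : ∀ t < N, x t = p) :
    discAvg d x = (1 - d ^ N) * p + d ^ N * discAvg d (fun t => x (N + t)) := by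
  induction N generalizing x with
  | zero => simp
  | succ N ih =>
    rw [discAvg_succ h0 h1 hx, ih (x := fun t => x (t + 1)) (fun t => hx _)
      (fun t ht => hp _ (by omega)), hp 0 (by omega)]
    have : ∀ t, N + t + 1 = N + 1 + t := fun t => by omega
    simp only [this]
    ring

/-- A power series with bounded coefficients that vanishes on `[d₀, 1)` has constant term zero. -/
lemma coeff_zero_of_discAvg_eq_zero {d₀ B : ℝ} (h0 : 0 ≤ d₀) (h1 : d₀ < 1) {x : ℕ → ℝ}
    (hx : ∀ t, |x t| ≤ B) (h : ∀ d ∈ Ico d₀ 1, discAvg d x = 0) : x 0 = 0 := by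
  set p := FormalMultilinearSeries.ofScalars ℝ x with hp
  have hr : ((1 : NNReal) : ENNReal) ≤ p.radius := by
    refine p.le_radius_of_bound B fun t => ?_
    simpa [hp, FormalMultilinearSeries.ofScalars_norm] using hx t
  have hball := (p.hasFPowerSeriesOnBall (lt_of_lt_of_le (by simp) hr)).mono (by simp) hr
  have hsum : ∀ d : ℝ, p.sum d = ∑' t : ℕ, d ^ t * x t := fun d => by
    have := FormalMultilinearSeries.ofScalars_sum_eq (E := ℝ) x d
    rw [FormalMultilinearSeries.ofScalarsSum] at this
    rw [hp, this]
    exact tsum_congr fun t => by simp [mul_comm]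
  have hz : EqOn p.sum 0 (Metric.eball 0 ((1 : NNReal) : ENNReal)) := by
    -- Identity theorem on the unit ball, based at an interior point of `[d₀, 1)`.
    refine hball.analyticOnNhd.eqOn_zero_of_preconnected_of_eventuallyEq_zero
      (z₀ := (d₀ + 1) / 2) ?_ ?_ ?_
    · rw [Metric.eball_coe]; exact (convex_ball _ _).isPreconnected
    · rw [Metric.eball_coe, Metric.mem_ball, Real.dist_eq, sub_zero, abs_of_nonneg (by linarith)]
      simp; linarith
    · filter_upwards [Ioo_mem_nhds (show d₀ < (d₀ + 1) / 2 by linarith)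
        (show (d₀ + 1) / 2 < 1 by linarith)] with d hd
      have := h d ⟨hd.1.le, hd.2⟩
      rw [discAvg, mul_eq_zero] at this
      rw [hsum]
      exact this.resolve_left (by linarith [hd.2])
  have := hz (x := 0) (by simp)
  rw [hsum, tsum_eq_single 0 (fun t ht => by simp [ht])] at this
  simpa using this

/-! ### Expectations under independent mixed profiles -/

section Game

variable {n : ℕ} {A : Fin n → Type*} [∀ i, Fintype (A i)]

lemma profileProb_nonneg (α : MixedProfile A) (a : Profile A) : 0 ≤ profileProb α a :=
  Finset.prod_nonneg fun i _ => (α i).2.1 (a i)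

lemma sum_profileProb (α : MixedProfile A) : ∑ a, profileProb α a = 1 := by
  classical
  have := Finset.prod_univ_sum (fun i : Fin n => (Finset.univ : Finset (A i)))
    (fun i a => (α i : A i → ℝ) a)
  rw [Fintype.piFinset_univ] at this
  simp only [profileProb]
  rw [← this]
  exact Finset.prod_eq_one fun i _ => (α i).2.2

/-- Expectation of `K` when the players mix according to `α`. -/
noncomputable def expect (α : MixedProfile A) (K : Profile A → ℝ) : ℝ :=
  ∑ a, profileProb α a * K a

lemma expect_const (α : MixedProfile A) (c : ℝ) : expect α (fun _ => c) = c := by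
  rw [expect, ← Finset.sum_mul, sum_profileProb, one_mul]

lemma expect_mono (α : MixedProfile A) {K L : Profile A → ℝ} (h : ∀ a, K a ≤ L a) :
    expect α K ≤ expect α L :=
  Finset.sum_le_sum fun a _ => mul_le_mul_of_nonneg_left (h a) (profileProb_nonneg α a)

lemma expect_congr (α : MixedProfile A) {K L : Profile A → ℝ}
    (h : ∀ a, profileProb α a ≠ 0 → K a = L a) : expect α K = expect α L :=
  Finset.sum_congr rfl fun a _ => by
    by_cases ha : profileProb α a = 0
    · simp [ha]
    · rw [h a ha]

lemma expect_add (α : MixedProfile A) (K L : Profile A → ℝ) :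
    expect α (fun a => K a + L a) = expect α K + expect α L := by
  simp [expect, mul_add, Finset.sum_add_distrib]

lemma expect_mul_left (α : MixedProfile A) (c : ℝ) (K : Profile A → ℝ) :
    expect α (fun a => c * K a) = c * expect α K := by
  rw [expect, expect, Finset.mul_sum]
  exact Finset.sum_congr rfl fun a _ => by ring

lemma reward_eq_expect (g : Profile A → Fin n → ℝ) (i : Fin n) (α : MixedProfile A) :
    reward g i α = expect α (fun a => g a i) := rfl

lemma abs_expect_le (α : MixedProfile A) {K : Profile A → ℝ} {B : ℝ} (h : ∀ a, |K a| ≤ B) :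
    |expect α K| ≤ B := by
  rw [abs_le]
  constructor
  · rw [← expect_const α (-B)]
    exact expect_mono α fun a => (abs_le.1 (h a)).1
  · calc _ ≤ expect α (fun _ => B) := expect_mono α fun a => (abs_le.1 (h a)).2
      _ = B := expect_const α B

lemma profileProb_update (α : MixedProfile A) (i : Fin n) (β : MixedAction A i) (x : Profile A) :
    profileProb (Function.update α i β) x =
      (β : A i → ℝ) (x i) * ∏ j ∈ Finset.univ.erase i, (α j : A j → ℝ) (x j) := by
  rw [profileProb, ← Finset.mul_prod_erase _ _ (Finset.mem_univ i), Function.update_self]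
  congr 1
  refine Finset.prod_congr rfl fun j hj => ?_
  rw [Function.update_of_ne (Finset.ne_of_mem_erase hj)]

lemma expect_eq_sum_update [∀ i, DecidableEq (A i)] (α : MixedProfile A) (i : Fin n)
    (K : Profile A → ℝ) :
    expect α K =
      ∑ a, (α i : A i → ℝ) a * expect (Function.update α i (pureAction a)) K := by
  simp only [expect, Finset.mul_sum]
  rw [Finset.sum_comm]
  refine Finset.sum_congr rfl fun x _ => ?_
  simp only [profileProb_update]
  rw [Finset.sum_eq_single (x i)]
  · have : profileProb α x = profileProb (Function.update α i (α i)) x := by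
      rw [Function.update_eq_self]
    rw [this, profileProb_update]
    simp [pureAction]; ring
  · intro b _ hb
    simp [pureAction, Ne.symm hb]
  · simp

/-- An upper bound for all pure actions of `i` is an upper bound for the mixed ones. -/
lemma expect_update_le [∀ i, DecidableEq (A i)] (α : MixedProfile A) (i : Fin n)
    (β : MixedAction A i) (K : Profile A → ℝ) {c : ℝ}
    (h : ∀ a, expect (Function.update α i (pureAction a)) K ≤ c) :
    expect (Function.update α i β) K ≤ c := by
  rw [expect_eq_sum_update _ i]
  simp only [Function.update_self, Function.update_idem]
  calc _ ≤ ∑ a, (β : A i → ℝ) a * c :=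
        Finset.sum_le_sum fun a _ => mul_le_mul_of_nonneg_left (h a) (β.2.1 a)
    _ = c := by
      rw [← Finset.sum_mul, show ∑ a, (β : A i → ℝ) a = 1 from β.2.2, one_mul]

lemma exists_abs_le (g : Profile A → Fin n → ℝ) : ∃ B, 0 ≤ B ∧ ∀ a i, |g a i| ≤ B := by
  refine ⟨∑ a, ∑ i, |g a i|, by positivity, fun a i => ?_⟩
  calc |g a i| ≤ ∑ i, |g a i| :=
        Finset.single_le_sum (f := fun i => |g a i|) (fun _ _ => abs_nonneg _) (Finset.mem_univ i)
    _ ≤ _ := Finset.single_le_sum (f := fun a => ∑ i, |g a i|)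
        (fun _ _ => by positivity) (Finset.mem_univ a)

/-! ### Recursive structure of payoffs -/

variable {g : Profile A → Fin n → ℝ}

lemma continuation_continuation (σ : StrategyProfile A) (h k : History A) :
    continuation (continuation σ h) k = continuation σ (h ++ k) := by
  funext i l; simp [continuation]

lemma continuation_nil (σ : StrategyProfile A) : continuation σ [] = σ := rfl

lemma expectedReward_zero (σ : StrategyProfile A) (i : Fin n) :
    expectedReward g σ i 0 = expect (fun j => σ j []) (fun a => g a i) := by
  unfold expectedReward
  rw [← (Equiv.funUnique (Fin 1) (Profile A)).symm.sum_comp]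
  refine Finset.sum_congr rfl fun a _ => ?_
  simp [historyProb]

/-- Conditioning on the first profile: a longer history is that profile followed by a history of the
continuation. -/
lemma expectedReward_succ (σ : StrategyProfile A) (i : Fin n) (t : ℕ) :
    expectedReward g σ i (t + 1) =
      expect (fun j => σ j []) (fun a => expectedReward g (continuation σ [a]) i t) := by
  unfold expectedReward
  rw [← (Fin.consEquiv fun _ : Fin (t + 2) => Profile A).sum_comp,
    Fintype.sum_prod_type]
  refine Finset.sum_congr rfl fun a _ => ?_
  rw [Finset.mul_sum]
  refine Finset.sum_congr rfl fun h _ => ?_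
  simp only [Fin.consEquiv, Equiv.coe_fn_mk, List.ofFn_cons, historyProb]
  rw [← Fin.succ_last, Fin.cons_succ, mul_assoc]

lemma abs_expectedReward_le {B : ℝ} {i : Fin n} (hB : ∀ a, |g a i| ≤ B) (σ : StrategyProfile A)
    (t : ℕ) : |expectedReward g σ i t| ≤ B := by
  induction t generalizing σ with
  | zero => rw [expectedReward_zero]; exact abs_expect_le _ hB
  | succ t ih => rw [expectedReward_succ]; exact abs_expect_le _ fun a => ih _

lemma payoff_eq_discAvg (σ : StrategyProfile A) (i : Fin n) (d : ℝ) :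
    payoff g σ i d = discAvg d (expectedReward g σ i) := rfl

lemma abs_payoff_le {B : ℝ} {i : Fin n} (hB : ∀ a, |g a i| ≤ B) (σ : StrategyProfile A) {d : ℝ}
    (h0 : 0 ≤ d) (h1 : d < 1) : |payoff g σ i d| ≤ B :=
  abs_discAvg_le h0 h1 (abs_expectedReward_le hB σ)

lemma payoff_eq_expect (σ : StrategyProfile A) (i : Fin n) {d : ℝ} (h0 : 0 ≤ d) (h1 : d < 1) :
    payoff g σ i d = expect (fun j => σ j [])
      (fun a => (1 - d) * g a i + d * payoff g (continuation σ [a]) i d) := by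
  obtain ⟨B, -, hB⟩ := exists_abs_le g
  rw [payoff_eq_discAvg, discAvg_succ h0 h1 (abs_expectedReward_le (hB · i) σ),
    expect_add, expect_mul_left, expect_mul_left, expectedReward_zero]
  congr 2
  simp only [expectedReward_succ, payoff_eq_discAvg, discAvg]
  rw [expect_mul_left]
  congr 1
  simp only [expect, Finset.mul_sum]
  rw [Summable.tsum_finsetSum]
  · refine Finset.sum_congr rfl fun a _ => ?_
    rw [← tsum_mul_left]
    exact tsum_congr fun t => by ring
  · intro a _
    have := (summable_disc h0 h1 (abs_expectedReward_le (hB · i) (continuation σ [a]))).mul_left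
      (profileProb (fun j => σ j []) a)
    exact this.congr fun t => by ring

lemma nonpos_of_le_pow_mul {x B d : ℝ} (h0 : 0 ≤ d) (h1 : d < 1) (h : ∀ N : ℕ, x ≤ d ^ N * B) :
    x ≤ 0 := by
  have := (tendsto_pow_atTop_nhds_zero_of_lt_one h0 h1).mul_const B
  rw [zero_mul] at this
  exact ge_of_tendsto' this h

/-- A bounded supersolution of the Bellman equation bounds the payoff from above. -/
lemma payoff_le_of_bellman {σ : StrategyProfile A} {i : Fin n} {d B : ℝ} (h0 : 0 ≤ d) (h1 : d < 1)
    (W : History A → ℝ) (hW : ∀ h, |W h| ≤ B)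
    (h : ∀ h, expect (fun j => σ j h) (fun a => (1 - d) * g a i + d * W (h ++ [a])) ≤ W h) :
    payoff g σ i d ≤ W [] := by
  obtain ⟨B', -, hB'⟩ := exists_abs_le g
  -- Each use of the Bellman inequality shrinks the crude initial bound by a factor `d`.
  have key : ∀ N : ℕ, ∀ k, payoff g (continuation σ k) i d - W k ≤ d ^ N * (B' + B) := by
    intro N
    induction N with
    | zero =>
      intro k
      have h2 := abs_le.1 (abs_payoff_le (hB' · i) (continuation σ k) h0 h1)
      have h3 := abs_le.1 (hW k)
      linarith [h2.2, h3.1]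
    | succ N ih =>
      intro k
      have e : payoff g (continuation σ k) i d = expect (fun j => σ j k)
          (fun a => (1 - d) * g a i + d * payoff g (continuation σ (k ++ [a])) i d) := by
        rw [payoff_eq_expect _ i h0 h1]
        simp [continuation_continuation, continuation]
      have : payoff g (continuation σ k) i d ≤ expect (fun j => σ j k)
          (fun a => ((1 - d) * g a i + d * W (k ++ [a])) + d * (d ^ N * (B' + B))) := by
        rw [e]
        refine expect_mono _ fun a => ?_
        linarith [mul_le_mul_of_nonneg_left (ih (k ++ [a])) h0]
      rw [expect_add, expect_const] at this
      have e2 : d ^ (N + 1) * (B' + B) = d * (d ^ N * (B' + B)) := by ring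
      linarith [h k]
  have := nonpos_of_le_pow_mul h0 h1 fun N => key N []
  rw [continuation_nil] at this
  linarith

lemma payoff_neg (σ : StrategyProfile A) (i : Fin n) (d : ℝ) :
    payoff (fun a => -g a) σ i d = -payoff g σ i d := by
  have : ∀ t, expectedReward (fun a => -g a) σ i t = -expectedReward g σ i t := fun t => by
    simp [expectedReward]
  simp [payoff, this, tsum_neg]

/-- A bounded subsolution of the Bellman equation bounds the payoff from below. -/
lemma le_payoff_of_bellman {σ : StrategyProfile A} {i : Fin n} {d B : ℝ} (h0 : 0 ≤ d) (h1 : d < 1)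
    (W : History A → ℝ) (hW : ∀ h, |W h| ≤ B)
    (h : ∀ h, W h ≤ expect (fun j => σ j h) (fun a => (1 - d) * g a i + d * W (h ++ [a]))) :
    W [] ≤ payoff g σ i d := by
  have := payoff_le_of_bellman (g := fun a => -g a) (σ := σ) (i := i) h0 h1 (fun h => -W h)
    (fun k => by simpa using hW k) fun k => by
      have e : ∀ a, (1 - d) * (-g a) i + d * -W (k ++ [a]) =
          (-1) * ((1 - d) * g a i + d * W (k ++ [a])) := fun a => by simp only [Pi.neg_apply]; ring
      simp only [e]
      rw [expect_mul_left]
      linarith [h k]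
  rw [payoff_neg] at this
  linarith

end Game

/-! ### Limit Blackwell payoffs dominate the MI-minmax payoffs -/

section Necessity

variable {n : ℕ} {A : Fin n → Type*} [∀ i, Fintype (A i)] {g : Profile A → Fin n → ℝ}

lemma isClosed_feasible (g : Profile A → Fin n → ℝ) : IsClosed (feasible g) :=
  ((finite_range g).isCompact_convexHull ℝ).isClosed

/-- With a common discount factor, payoff vectors are feasible. -/
lemma payoffVector_mem_feasible [∀ i, Nonempty (A i)] (σ : StrategyProfile A) {d : ℝ} (h0 : 0 ≤ d) (h1 : d < 1) :
    payoffVector g σ (fun _ => d) ∈ feasible g := by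
  obtain ⟨B, -, hB⟩ := exists_abs_le g
  have hg : ∀ a, g a ∈ feasible g := fun a => subset_convexHull ℝ _ (mem_range_self a)
  -- Since all players share `d`, current and continuation vectors enter with the same convex
  -- weights in every coordinate; only the part beyond `N` rounds is approximated.
  have key : ∀ (N : ℕ) (σ : StrategyProfile A),
      ∃ z ∈ feasible g, ∀ i, |payoff g σ i d - z i| ≤ d ^ N * (B + B) := by
    intro N
    induction N with
    | zero =>
      intro σ
      refine ⟨g fun i => Classical.arbitrary (A i), hg _, fun i => ?_⟩
      rw [pow_zero, one_mul]
      exact (abs_sub _ _).trans (add_le_add (abs_payoff_le (hB · i) σ h0 h1) (hB _ i))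
    | succ N ih =>
      intro σ
      choose z hz hzd using fun a => ih (continuation σ [a])
      refine ⟨∑ a, profileProb (fun j => σ j []) a • ((1 - d) • g a + d • z a), ?_, fun i => ?_⟩
      · refine (convex_convexHull ℝ (range g)).sum_mem (fun a _ => profileProb_nonneg _ a)
          (sum_profileProb _) fun a _ => ?_
        exact convex_convexHull ℝ (range g) (hg a) (hz a) (by linarith) h0 (by ring)
      · have e : payoff g σ i d -
            (∑ a, profileProb (fun j => σ j []) a • ((1 - d) • g a + d • z a)) i =
            expect (fun j => σ j []) fun a => d * (payoff g (continuation σ [a]) i d - z a i) := by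
          rw [payoff_eq_expect σ i h0 h1, Finset.sum_apply]
          simp only [expect]
          rw [← Finset.sum_sub_distrib]
          refine Finset.sum_congr rfl fun a _ => ?_
          simp only [Pi.smul_apply, Pi.add_apply, smul_eq_mul]
          ring
        rw [e]
        refine abs_expect_le _ fun a => ?_
        rw [abs_mul, abs_of_nonneg h0, pow_succ']
        calc d * _ ≤ d * (d ^ N * (B + B)) := mul_le_mul_of_nonneg_left (hzd a i) h0
          _ = _ := by ring
  rw [← (isClosed_feasible g).closure_eq]
  choose z hz hzd using fun N => key N σ
  refine mem_closure_of_tendsto (f := z) (b := atTop) ?_ (Eventually.of_forall hz)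
  rw [tendsto_pi_nhds]
  intro i
  have h2 := (tendsto_pow_atTop_nhds_zero_of_lt_one h0 h1).mul_const (B + B)
  rw [zero_mul] at h2
  rw [tendsto_iff_norm_sub_tendsto_zero]
  refine squeeze_zero (fun _ => norm_nonneg _) (fun N => ?_) h2
  rw [Real.norm_eq_abs, abs_sub_comm]
  exact hzd N i

variable [∀ i, DecidableEq (A i)]

/-- A profile that is Nash for all large common discount factors starts with a myopically
indifferent profile. -/
lemma mem_myopicIndiff_of_isNash {σ : StrategyProfile A} {d₀ : ℝ} (h0 : 0 ≤ d₀) (h1 : d₀ < 1)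
    (hσ : ∀ d ∈ Ico d₀ 1, IsNash g (fun _ => d) σ) : (fun j => σ j []) ∈ myopicIndiff g := by
  intro i a ha
  obtain ⟨B, -, hB⟩ := exists_abs_le g
  -- `τ b` plays `b` once and then returns to `σ`.
  let τ : A i → StrategyProfile A := fun b =>
    Function.update σ i (fun h => if h = [] then pureAction b else σ i h)
  have hτ0 : ∀ b, (fun j => τ b j []) = Function.update (fun j => σ j []) i (pureAction b) := by
    intro b; funext j
    by_cases hj : j = i
    · subst hj; simp [τ]
    · simp [τ, hj]
  have hτc : ∀ b x, continuation (τ b) [x] = continuation σ [x] := by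
    intro b x; funext j k
    by_cases hj : j = i
    · subst hj; simp [τ, continuation]
    · simp [τ, hj, continuation]
  have heq : ∀ d ∈ Ico d₀ 1, payoff g (τ a) i d = payoff g σ i d := by
    intro d hd
    have hd0 := h0.trans hd.1
    have hle : ∀ b, payoff g (τ b) i d ≤ payoff g σ i d := fun b => hσ d hd i _
    -- The payoff of `σ` is the average of those of the `τ b`, none of which exceeds it; so no
    -- supported `b` falls short.
    have hsum : ∑ b, (σ i [] : A i → ℝ) b * (payoff g σ i d - payoff g (τ b) i d) = 0 := by
      simp only [mul_sub, Finset.sum_sub_distrib]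
      rw [← Finset.sum_mul, show ∑ b, (σ i [] : A i → ℝ) b = 1 from (σ i []).2.2, one_mul,
        sub_eq_zero]
      conv_lhs => rw [payoff_eq_expect σ i hd0 hd.2, expect_eq_sum_update _ i]
      refine Finset.sum_congr rfl fun b _ => ?_
      rw [payoff_eq_expect (τ b) i hd0 hd.2, hτ0]
      simp only [hτc]
    have := (Finset.sum_eq_zero_iff_of_nonneg fun b _ =>
      mul_nonneg ((σ i []).2.1 b) (sub_nonneg.2 (hle b))).1 hsum a (Finset.mem_univ a)
    have := (mul_eq_zero.1 this).resolve_left ha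
    linarith
  have hz := coeff_zero_of_discAvg_eq_zero (B := B + B) h0 h1
    (x := fun t => expectedReward g (τ a) i t - expectedReward g σ i t)
    (fun t => (abs_sub _ _).trans (add_le_add (abs_expectedReward_le (hB · i) _ t)
      (abs_expectedReward_le (hB · i) _ t))) fun d hd => by
        rw [discAvg_sub (h0.trans hd.1) hd.2 (abs_expectedReward_le (hB · i) _)
          (abs_expectedReward_le (hB · i) _)]
        have := heq d hd
        rw [payoff_eq_discAvg, payoff_eq_discAvg] at this
        linarith
  simp only [expectedReward_zero, hτ0, sub_eq_zero] at hz
  exact hz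

/-- An arbitrarily small move towards a point of `feasibleMI g` makes the weak inequalities strict.
-/
lemma mem_closure_feasibleMI (hne : (feasibleMI g).Nonempty) {v : Fin n → ℝ}
    (hv : v ∈ feasible g) (hmin : ∀ i, miMinmax g i ≤ v i) : v ∈ closure (feasibleMI g) := by
  obtain ⟨w, hw, hw'⟩ := hne
  have ht : Tendsto (fun ε : ℝ => v + ε • (w - v)) (𝓝[>] 0) (𝓝 v) := by
    have : Continuous fun ε : ℝ => v + ε • (w - v) := by fun_prop
    simpa using (this.tendsto 0).mono_left nhdsWithin_le_nhds
  refine mem_closure_of_tendsto ht ?_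
  filter_upwards [Ioo_mem_nhdsGT (show (0 : ℝ) < 1 by norm_num)] with ε hε
  refine ⟨?_, fun i => ?_⟩
  · exact (convex_convexHull ℝ (range g)).add_smul_sub_mem hv hw ⟨hε.1.le, hε.2.le⟩
  · simp only [Pi.add_apply, Pi.smul_apply, Pi.sub_apply, smul_eq_mul]
    nlinarith [hw' i, hmin i, hε.1, hε.2]

variable [∀ i, Nonempty (A i)]

lemma bddBelow_sup_devReward (i : Fin n) :
    BddBelow ((fun α : MixedProfile A => ⨆ a : A i, devReward g i a α) '' myopicIndiff g) := by
  obtain ⟨B, -, hB⟩ := exists_abs_le g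
  refine ⟨-B, ?_⟩
  rintro _ ⟨α, -, rfl⟩
  obtain ⟨a⟩ := ‹∀ i, Nonempty (A i)› i
  exact (abs_le.1 (abs_expect_le _ (hB · i))).1.trans
    (le_ciSup (f := fun a : A i => devReward g i a α) (Set.finite_range _).bddAbove a)

lemma exists_miMinmax_le_devReward {α : MixedProfile A} (hα : α ∈ myopicIndiff g) (i : Fin n) :
    ∃ a, miMinmax g i ≤ devReward g i a α := by
  obtain ⟨a, ha⟩ := exists_eq_ciSup_of_finite (f := fun a : A i => devReward g i a α)
  exact ⟨a, ha ▸ csInf_le (bddBelow_sup_devReward i) ⟨α, hα, rfl⟩⟩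

/-- The others' play is part of a myopically indifferent profile after every history, including
those created by deviating, so a myopic best reply secures `miMinmax` round by round. The same reply
works for all `d`; the constant `miMinmax g i` is a Bellman subsolution. -/
lemma exists_miMinmax_le_payoff {σ : StrategyProfile A}
    (hσ : ∀ h, (fun j => σ j h) ∈ myopicIndiff g) (i : Fin n) :
    ∃ τ : Strategy A i, ∀ d : ℝ, 0 ≤ d → d < 1 →
      miMinmax g i ≤ payoff g (Function.update σ i τ) i d := by
  choose b hb using fun h => exists_miMinmax_le_devReward (hσ h) i
  refine ⟨fun h => pureAction (b h), fun d h0 h1 => ?_⟩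
  refine le_payoff_of_bellman (B := |miMinmax g i|) h0 h1 (fun _ => miMinmax g i)
    (fun _ => le_rfl) fun h => ?_
  have e : (fun j => Function.update σ i (fun h => pureAction (b h)) j h) =
      Function.update (fun j => σ j h) i (pureAction (b h)) := by
    funext j
    by_cases hj : j = i
    · subst hj; simp
    · simp [hj]
  have := hb h
  rw [devReward, reward_eq_expect] at this
  rw [expect_add, expect_const, expect_mul_left, e]
  nlinarith

/-- Limit Blackwell payoffs are feasible and weakly above the MI-minmax payoffs. -/
lemma IsLimitBlackwellPayoff.mem_feasible_and_le {v : Fin n → ℝ}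
    (hv : IsLimitBlackwellPayoff g v) : v ∈ feasible g ∧ ∀ i, miMinmax g i ≤ v i := by
  obtain ⟨σ, ⟨d₀, hd₀, hσ⟩, hlim⟩ := hv
  -- Common discount factors suffice to identify the limit.
  have hdiag : Tendsto (fun d : ℝ => (fun _ : Fin n => d)) (𝓝[<] 1)
      (𝓝[{δ | ∀ i, δ i ∈ Ico (0 : ℝ) 1}] (fun _ => 1)) := by
    refine tendsto_nhdsWithin_iff.2 ⟨?_, ?_⟩
    · exact (continuous_pi fun _ => continuous_id).continuousAt.tendsto.mono_left
        nhdsWithin_le_nhds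
    · filter_upwards [Ico_mem_nhdsLT (show (0 : ℝ) < 1 by norm_num)] with d hd i using hd
  have hlim' := hlim.comp hdiag
  refine ⟨(isClosed_feasible g).mem_of_tendsto hlim' ?_, fun i => ?_⟩
  · filter_upwards [Ico_mem_nhdsLT (show (0 : ℝ) < 1 by norm_num)] with d hd
    exact payoffVector_mem_feasible σ hd.1 hd.2
  · have hMI : ∀ h, (fun j => σ j h) ∈ myopicIndiff g := fun h => by
      have := mem_myopicIndiff_of_isNash (g := g) (σ := continuation σ h) hd₀.1 hd₀.2
        fun d hd => hσ (fun _ => d) (fun _ => hd) h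
      simpa [continuation] using this
    obtain ⟨τ, hτ⟩ := exists_miMinmax_le_payoff hMI i
    refine ge_of_tendsto ((tendsto_pi_nhds.1 hlim') i) ?_
    filter_upwards [Ico_mem_nhdsLT hd₀.2] with d hd
    exact (hτ d (hd₀.1.trans hd.1) hd.2).trans (hσ (fun _ => d) (fun _ => hd) [] i τ)

end Necessity

/-! ### Deterministic sequences with bounded discrepancy -/

/-- Greedy apportionment: a sequence in which every `k` has frequency `w k` up to a bounded
error. -/
lemma exists_seq_bounded_deficit {ι : Type*} [Fintype ι] [Nonempty ι] [DecidableEq ι] {w : ι → ℝ}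
    (hw : ∀ k, 0 ≤ w k) (hw1 : ∑ k, w k = 1) :
    ∃ (j : ℕ → ι) (D : ℕ → ι → ℝ), (∀ k, D 0 k = 0) ∧
      (∀ t k, D (t + 1) k = D t k + w k - if j t = k then 1 else 0) ∧
      ∀ t k, |D t k| ≤ Fintype.card ι := by
  have hmax : ∀ f : ι → ℝ, ∃ k, ∀ l, f l ≤ f k := Finite.exists_max
  choose pick hpick using hmax
  let D : ℕ → ι → ℝ := fun t => Nat.rec (fun _ => 0)
    (fun _ E k => E k + w k - if pick (fun l => E l + w l) = k then 1 else 0) t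
  have hsucc : ∀ t k, D (t + 1) k =
      D t k + w k - if pick (fun l => D t l + w l) = k then 1 else 0 := fun _ _ => rfl
  have hsum : ∀ t, ∑ k, D t k = 0 := by
    intro t
    induction t with
    | zero => simp [D]
    | succ t ih =>
      simp only [hsucc, Finset.sum_sub_distrib, Finset.sum_add_distrib, ih, hw1]
      simp
  have hlow : ∀ t k, -1 ≤ D t k := by
    intro t
    induction t with
    | zero => intro k; simp [D]
    | succ t ih =>
      intro k
      rw [hsucc]
      split_ifs with hk
      -- The picked entry is the largest of numbers with sum 1, so it is not negative.
      · have : 0 ≤ D t k + w k := by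
          by_contra hneg
          push Not at hneg
          have hlt : ∑ l, (D t l + w l) < ∑ _l : ι, (0 : ℝ) :=
            Finset.sum_lt_sum_of_nonempty Finset.univ_nonempty fun l _ =>
              ((hpick (fun l => D t l + w l) l).trans_eq (by rw [hk])).trans_lt hneg
          rw [Finset.sum_add_distrib, hsum, hw1] at hlt
          simp at hlt
          linarith
        linarith
      · linarith [ih k, hw k]
  refine ⟨fun t => pick fun l => D t l + w l, D, fun _ => rfl, hsucc, fun t k => ?_⟩
  have hcard : (1 : ℝ) ≤ Fintype.card ι := by exact_mod_cast Fintype.card_pos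
  rw [abs_le]
  refine ⟨by linarith [hlow t k], ?_⟩
  -- Entries at least -1 with sum zero are also bounded above.
  have h1 : D t k + 1 ≤ ∑ l, (D t l + 1) :=
    Finset.single_le_sum (f := fun l => D t l + 1) (fun l _ => by linarith [hlow t l])
      (Finset.mem_univ k)
  rw [Finset.sum_add_distrib, hsum] at h1
  simp at h1
  linarith

/-- Bounded partial sums after a finite prefix are bounded partial sums. -/
lemma abs_partialSum_le_of_tail {x : ℕ → ℝ} {B C : ℝ} (N : ℕ) (hB : 0 ≤ B) (hx : ∀ t, |x t| ≤ B)
    (hC : ∀ T, |∑ t ∈ Finset.range T, x (N + t)| ≤ C) (T : ℕ) :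
    |∑ t ∈ Finset.range T, x t| ≤ N * B + C := by
  have hpre : ∀ M : ℕ, |∑ t ∈ Finset.range M, x t| ≤ M * B := fun M => by
    refine (Finset.abs_sum_le_sum_abs _ _).trans ((Finset.sum_le_sum fun t _ => hx t).trans ?_)
    simp
  rcases le_total T N with h | h
  · have h2 : (T : ℝ) * B ≤ N * B := mul_le_mul_of_nonneg_right (by exact_mod_cast h) hB
    have h3 := hC 0
    simp at h3
    linarith [hpre T]
  · obtain ⟨S, rfl⟩ := Nat.exists_eq_add_of_le h
    rw [Finset.sum_range_add]
    exact (abs_add_le _ _).trans (add_le_add (hpre N) (hC S))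

/-- Incentives in a three-phase construction, for one player. Index `q` stands for the path that
follows a deviation of this player: it starts with `N` rounds at reward `p`, in which deviating
gives at most `c`. -/
lemma eventually_deviation_le {P : Type*} [Finite P] {r : P → ℕ → ℝ} {m : P → ℝ} {q : P}
    {B C K p c : ℝ} {N : ℕ} (hr : ∀ s t, |r s t| ≤ B)
    (hC : ∀ s T, |∑ t ∈ Finset.range T, (r s t - m s)| ≤ C)
    (hK : ∀ T, |∑ t ∈ Finset.range T, (r q (N + t) - m q)| ≤ K)
    (hm : ∀ s, s ≠ q → m q < m s) (hp : ∀ t < N, r q t = p) (hpc : p ≤ c) (hcm : c < m q)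
    (hN : B + 4 * K - m q < N * (m q - p)) :
    ∀ᶠ d in 𝓝[<] (1 : ℝ), ∀ s t D, |D| ≤ B → (s = q → t < N → D ≤ c) →
      (1 - d) * D + d * discAvg d (fun k => r q (0 + k)) ≤ discAvg d (fun k => r s (t + k)) := by
  have hcont : ∀ f : ℝ → ℝ, Continuous f → f 1 < 0 → ∀ᶠ d in 𝓝[<] (1 : ℝ), f d < 0 :=
    fun f hf h1 => nhdsWithin_le_nhds ((hf.tendsto 1).eventually_lt_const h1)
  have hA : ∀ᶠ d in 𝓝[<] (1 : ℝ), ∀ s, s ≠ q →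
      (1 - d) * B + d * (m q + 2 * C * (1 - d)) - (m s - 2 * C * (1 - d)) < 0 := by
    refine eventually_all.2 fun s => ?_
    by_cases hs : s = q
    · exact Eventually.of_forall fun d h => absurd hs h
    · filter_upwards [hcont (fun d => (1 - d) * B + d * (m q + 2 * C * (1 - d)) -
        (m s - 2 * C * (1 - d))) (by fun_prop) (by simpa using hm s hs)] with d hd _ using hd
  have hBev := hcont (fun d => c - (m q - 2 * C * (1 - d))) (by fun_prop) (by simpa using hcm)
  -- The deviation gain after the block, divided by `1 - d`. At `d = 1` it is `B - m q + N * (p - m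
  -- q) + 4 * K`, negative by `hN`.
  have hCev := hcont (fun d => B - m q + d * (∑ k ∈ Finset.range N, d ^ k) * (p - m q) +
    d ^ (N + 1) * (2 * K) + 2 * K) (by fun_prop) (by simp; linarith)
  filter_upwards [hA, hBev, hCev, Ioo_mem_nhdsLT (show (0 : ℝ) < 1 by norm_num)]
    with d hA hB' hC' hd s t D hD hDc
  have h0 := hd.1.le
  have h1 := hd.2
  have tail := fun s t => abs_le.1 (abs_discAvg_tail_sub_le h0 h1 (hr s) (hC s) t)
  have hDB := (abs_le.1 hD).2
  have hDB' : (1 - d) * D ≤ (1 - d) * B := mul_le_mul_of_nonneg_left hDB (by linarith)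
  by_cases hs : s = q
  · subst hs
    set W := discAvg d (fun k => r s (0 + k)) with hW
    have hcW : c ≤ W := by linarith [(tail s 0).1]
    rcases lt_or_ge t N with ht | ht
    -- Block rounds pay `p ≤ c ≤ W`, so the value does not fall below `W` as they are worked off;
    -- restarting the block cannot help.
    · have hmono : ∀ t ≤ N, W ≤ discAvg d (fun k => r s (t + k)) := by
        intro t
        induction t with
        | zero => intro _; exact le_rfl
        | succ t ih =>
          intro ht
          have ih := ih (by omega)
          rw [discAvg_succ h0 h1 (fun k => hr s (t + k)), add_zero, hp t (by omega)] at ih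
          have e : (fun k => r s (t + (k + 1))) = fun k => r s (t + 1 + k) := by
            funext k; congr 1; omega
          rw [e] at ih
          have : d * W ≤ d * discAvg d (fun k => r s (t + 1 + k)) := by nlinarith
          exact le_of_mul_le_mul_left this hd.1
      have h2 := hmono t ht.le
      have h3 : (1 - d) * D ≤ (1 - d) * W :=
        mul_le_mul_of_nonneg_left ((hDc rfl ht).trans hcW) (by linarith)
      linarith
    · obtain ⟨k, rfl⟩ := Nat.exists_eq_add_of_le ht
      have tail' := fun k => abs_le.1 (abs_discAvg_tail_sub_le h0 h1
        (x := fun t => r s (N + t)) (fun t => hr s (N + t)) hK k)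
      have hV := (tail' k).1
      have hV0 := (tail' 0).2
      simp only [zero_add, ← add_assoc] at hV hV0
      have hWeq : W = (1 - d ^ N) * p + d ^ N * discAvg d (fun k => r s (N + k)) := by
        rw [hW]
        simp only [zero_add]
        exact discAvg_eq_of_prefix h0 h1 N (hr s) hp
      have hgeom : (∑ k ∈ Finset.range N, d ^ k) * (1 - d) = 1 - d ^ N := by
        have := geom_sum_mul d N
        linarith
      set G := ∑ k ∈ Finset.range N, d ^ k
      have h4 : d * d ^ N * discAvg d (fun k => r s (N + k)) ≤
          d * d ^ N * (m s + 2 * K * (1 - d)) :=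
        mul_le_mul_of_nonneg_left (by linarith) (by positivity)
      have h5 : (1 - d) * (B - m s + d * G * (p - m s) + d ^ (N + 1) * (2 * K) + 2 * K) ≤ 0 :=
        mul_nonpos_of_nonneg_of_nonpos (by linarith) hC'.le
      have h6 : (1 - d) * (B - m s + d * G * (p - m s) + d ^ (N + 1) * (2 * K) + 2 * K) =
          (1 - d) * B - (1 - d) * m s + d * (1 - d ^ N) * (p - m s) +
            d * d ^ N * (2 * K) * (1 - d) + 2 * K * (1 - d) := by
        rw [← hgeom]; ring
      rw [hWeq]
      linarith
  · have h2 := (tail q 0).2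
    have h3 := (tail s t).1
    have h4 : d * discAvg d (fun k => r q (0 + k)) ≤ d * (m q + 2 * C * (1 - d)) :=
      mul_le_mul_of_nonneg_left (by linarith) h0
    linarith [hA s hs]

/-! ### Target sequences and player-specific punishment payoffs -/

section Sufficiency

variable {n : ℕ} {A : Fin n → Type*} [∀ i, Fintype (A i)] {g : Profile A → Fin n → ℝ}

/-- Every feasible vector is the uniform limit average of a deterministic sequence of pure
profiles. -/
lemma exists_seq_of_mem_feasible {v : Fin n → ℝ} (hv : v ∈ feasible g) :
    ∃ (a : ℕ → Profile A) (C : ℝ), ∀ i T, |∑ t ∈ Finset.range T, (g (a t) i - v i)| ≤ C := by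
  classical
  obtain ⟨ι, _, w, z, hw, hw1, hz, rfl⟩ := mem_convexHull_iff_exists_fintype.1 hv
  choose b hb using hz
  have : Nonempty ι := by
    by_contra h
    rw [not_nonempty_iff] at h
    simp at hw1
  obtain ⟨j, D, hD0, hDs, hD⟩ := exists_seq_bounded_deficit hw hw1
  obtain ⟨B, hB0, hB⟩ := exists_abs_le g
  refine ⟨fun t => b (j t), ∑ _k : ι, Fintype.card ι * B, fun i T => ?_⟩
  -- The accumulated payoff error is a fixed linear function of the bounded deficits.
  have key : ∑ t ∈ Finset.range T, (g (b (j t)) i - (∑ k, w k • z k) i) =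
      -∑ k, D T k * g (b k) i := by
    induction T with
    | zero => simp [hD0]
    | succ T ih =>
      rw [Finset.sum_range_succ, ih]
      simp only [hDs, add_mul, sub_mul, Finset.sum_add_distrib, Finset.sum_sub_distrib, hb]
      simp
      ring
  rw [key, abs_neg]
  refine (Finset.abs_sum_le_sum_abs _ _).trans (Finset.sum_le_sum fun k _ => ?_)
  rw [abs_mul]
  exact mul_le_mul (hD T k) (hB _ i) (abs_nonneg _) (by positivity)

/-- Player-specific punishment payoffs, from full dimensionality. -/
lemma exists_punishment_payoffs (hdim : dimension (feasible g) = n) {v c : Fin n → ℝ}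
    (hv : v ∈ feasible g) (hc : ∀ j, c j < v j) (hlow : ∀ j, ∃ a, g a j < v j) :
    ∃ w : Fin n → Fin n → ℝ, ∀ j, w j ∈ feasible g ∧ c j < w j j ∧ w j j < v j ∧
      ∀ i, i ≠ j → w j j < w i j := by
  have hconv : Convex ℝ (feasible g) := convex_convexHull ℝ (range g)
  have hint : (interior (feasible g)).Nonempty := by
    rw [hconv.interior_nonempty_iff_affineSpan_eq_top,
      AffineSubspace.affineSpan_eq_top_iff_vectorSpan_eq_top_of_nonempty ℝ _ _ ⟨v, hv⟩]
    refine Submodule.eq_top_of_finrank_eq ?_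
    rw [Module.finrank_fin_fun]
    exact hdim
  obtain ⟨u, hu⟩ := hint
  obtain ⟨ρ, hρ, hball⟩ := Metric.mem_nhds_iff.1 (mem_interior_iff_mem_nhds.1 hu)
  -- Mixing `v` with the worst profile for `j` separates the punishments only weakly; the small
  -- weight on `x j`, lowered in coordinate `j` alone, makes the comparison strict.
  let x : Fin n → Fin n → ℝ := fun j => u - Pi.single j (ρ / 2)
  have hx : ∀ j, x j ∈ feasible g := fun j => hball <| by
    rw [Metric.mem_ball, dist_eq_norm]
    simp only [x, sub_sub_cancel_left, norm_neg, Pi.norm_single, Real.norm_eq_abs]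
    rw [abs_of_pos (by positivity)]
    linarith
  have hmin : ∀ j, ∃ a, ∀ b, g a j ≤ g b j := fun j => by
    obtain ⟨a, -⟩ := hlow j
    have : Nonempty (Profile A) := ⟨a⟩
    exact Finite.exists_min fun a => g a j
  choose a ha using hmin
  have hav : ∀ j, g (a j) j < v j := fun j => by
    obtain ⟨b, hb⟩ := hlow j
    exact (ha j b).trans_lt hb
  have hev : ∀ f : ℝ → ℝ, Continuous f → f 0 < 0 → ∀ᶠ η in 𝓝[>] (0 : ℝ), f η < 0 :=
    fun f hf h => nhdsWithin_le_nhds ((hf.tendsto 0).eventually_lt_const h)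
  obtain ⟨η, hη, hη0⟩ : ∃ η : ℝ, (∀ j, (g (a j) j - v j) + η * (x j j - v j) < 0) ∧ 0 < η := by
    refine Eventually.exists (f := 𝓝[>] (0 : ℝ)) (Eventually.and (eventually_all.2 fun j => ?_)
      self_mem_nhdsWithin)
    exact hev (fun η => (g (a j) j - v j) + η * (x j j - v j)) (by fun_prop)
      (by simpa using hav j)
  obtain ⟨θ, hθc, hθ1, hθ0⟩ : ∃ θ : ℝ,
      (∀ j, c j - (v j + θ * ((g (a j) j - v j) + η * (x j j - v j))) < 0) ∧
        θ * (1 + η) - 1 < 0 ∧ 0 < θ := by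
    refine Eventually.exists (f := 𝓝[>] (0 : ℝ)) (Eventually.and (eventually_all.2 fun j => ?_)
      (Eventually.and ?_ self_mem_nhdsWithin))
    · exact hev (fun θ => c j - (v j + θ * ((g (a j) j - v j) + η * (x j j - v j))))
        (by fun_prop) (by simpa using hc j)
    · exact hev (fun θ => θ * (1 + η) - 1) (by fun_prop) (by simp)
  refine ⟨fun j => (1 - θ * (1 + η)) • v + (θ • g (a j) + (θ * η) • x j), fun j => ?_⟩
  have hval : ∀ i, ((1 - θ * (1 + η)) • v + (θ • g (a i) + (θ * η) • x i)) j =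
      v j + θ * ((g (a i) j - v j) + η * (x i j - v j)) := fun i => by
    simp only [Pi.add_apply, Pi.smul_apply, smul_eq_mul]
    ring
  refine ⟨?_, ?_, ?_, fun i hij => ?_⟩
  · have hga : g (a j) ∈ feasible g := subset_convexHull ℝ _ (mem_range_self _)
    have := hconv.sum_mem (t := Finset.univ) (w := ![1 - θ * (1 + η), θ, θ * η])
      (z := ![v, g (a j), x j]) (fun k _ => by
        fin_cases k
        · show 0 ≤ 1 - θ * (1 + η)
          linarith
        · exact hθ0.le
        · exact (mul_pos hθ0 hη0).le) (by simp [Fin.sum_univ_three]; ring) (fun k _ => by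
        fin_cases k
        · exact hv
        · exact hga
        · exact hx j)
    simpa [Fin.sum_univ_three, add_assoc] using this
  · refine lt_of_lt_of_eq ?_ (hval j).symm
    linarith [hθc j]
  · refine (hval j).trans_lt ?_
    nlinarith [hη j]
  · refine (hval j).trans_lt (lt_of_lt_of_eq ?_ (hval i).symm)
    have h1 := ha j (a i)
    have h2 : x j j < x i j := by
      simp only [x, Pi.sub_apply, Pi.single_eq_same, Pi.single_eq_of_ne (Ne.symm hij)]
      linarith
    have h3 : η * x j j < η * x i j := mul_lt_mul_of_pos_left h2 hη0
    have h4 := mul_lt_mul_of_pos_left (show (g (a j) j - v j) + η * (x j j - v j) <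
      (g (a i) j - v j) + η * (x i j - v j) by linarith) hθ0
    linarith

end Sufficiency

/-! ### Automaton strategies -/

section Automaton

variable {n : ℕ} {A : Fin n → Type*} [∀ i, Fintype (A i)] {g : Profile A → Fin n → ℝ}

open Classical in
/-- State transition: continue along the current path unless some player leaves the support of
the prescribed mixed action; then start the path of such a player. -/
noncomputable def automatonStep (β : Option (Fin n) → ℕ → MixedProfile A)
    (s : Option (Fin n) × ℕ) (a : Profile A) : Option (Fin n) × ℕ :=
  if h : ∃ i, (β s.1 s.2 i : A i → ℝ) (a i) = 0 then (some h.choose, 0) else (s.1, s.2 + 1)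

/-- State of the automaton after a history; the initial path is `none`. -/
noncomputable def automatonState (β : Option (Fin n) → ℕ → MixedProfile A) (h : History A) :
    Option (Fin n) × ℕ :=
  h.foldl (automatonStep β) (none, 0)

/-- The strategy profile that plays along the paths `β` and switches between them by
`automatonStep`. -/
noncomputable def automaton (β : Option (Fin n) → ℕ → MixedProfile A) : StrategyProfile A :=
  fun i h => β (automatonState β h).1 (automatonState β h).2 i

lemma automatonState_append (β : Option (Fin n) → ℕ → MixedProfile A) (h : History A)
    (a : Profile A) :
    automatonState β (h ++ [a]) = automatonStep β (automatonState β h) a := by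
  simp [automatonState]

lemma automatonStep_of_ne_zero {β : Option (Fin n) → ℕ → MixedProfile A}
    {s : Option (Fin n) × ℕ} {a : Profile A} (h : ∀ i, (β s.1 s.2 i : A i → ℝ) (a i) ≠ 0) :
    automatonStep β s a = (s.1, s.2 + 1) := by
  rw [automatonStep, dif_neg]
  simpa using h

/-- The choice of whom to punish is arbitrary after joint deviations, but forced after a unilateral
one. -/
lemma automatonStep_of_unique_deviator {β : Option (Fin n) → ℕ → MixedProfile A}
    {s : Option (Fin n) × ℕ} {a : Profile A} {i : Fin n}
    (hi : (β s.1 s.2 i : A i → ℝ) (a i) = 0)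
    (h : ∀ j, j ≠ i → (β s.1 s.2 j : A j → ℝ) (a j) ≠ 0) :
    automatonStep β s a = (some i, 0) := by
  have hex : ∃ i, (β s.1 s.2 i : A i → ℝ) (a i) = 0 := ⟨i, hi⟩
  rw [automatonStep, dif_pos hex]
  have : hex.choose = i := by
    by_contra hne
    exact h _ hne hex.choose_spec
  rw [this]

/-- Discounted value of following the path of the state `s`. -/
noncomputable def pathValue (g : Profile A → Fin n → ℝ) (β : Option (Fin n) → ℕ → MixedProfile A)
    (i : Fin n) (d : ℝ) (s : Option (Fin n) × ℕ) : ℝ :=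
  discAvg d fun k => reward g i (β s.1 (s.2 + k))

lemma abs_reward_le {B : ℝ} (hB : ∀ a i, |g a i| ≤ B) (i : Fin n) (α : MixedProfile A) :
    |reward g i α| ≤ B :=
  abs_expect_le α (hB · i)

lemma pathValue_eq {β : Option (Fin n) → ℕ → MixedProfile A} {i : Fin n} {d : ℝ} (h0 : 0 ≤ d)
    (h1 : d < 1) (s : Option (Fin n) × ℕ) :
    pathValue g β i d s =
      (1 - d) * reward g i (β s.1 s.2) + d * pathValue g β i d (s.1, s.2 + 1) := by
  obtain ⟨B, -, hB⟩ := exists_abs_le g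
  rw [pathValue, discAvg_succ h0 h1 fun k => abs_reward_le hB i _]
  have e : (fun k => reward g i (β s.1 (s.2 + (k + 1)))) =
      fun k => reward g i (β s.1 (s.2 + 1 + k)) := by
    funext k; congr 2; omega
  rw [e, add_zero, pathValue]

lemma ne_zero_of_profileProb_ne_zero {α : MixedProfile A} {a : Profile A}
    (h : profileProb α a ≠ 0) (i : Fin n) : (α i : A i → ℝ) (a i) ≠ 0 :=
  Finset.prod_ne_zero_iff.1 h i (Finset.mem_univ i)

lemma expect_step_eq_pathValue {β : Option (Fin n) → ℕ → MixedProfile A} {i : Fin n} {d : ℝ}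
    (h0 : 0 ≤ d) (h1 : d < 1) (s : Option (Fin n) × ℕ) :
    expect (β s.1 s.2) (fun a => (1 - d) * g a i + d * pathValue g β i d (automatonStep β s a)) =
      pathValue g β i d s := by
  rw [pathValue_eq h0 h1 s, reward_eq_expect, ← expect_mul_left,
    ← expect_const (β s.1 s.2) (d * pathValue g β i d (s.1, s.2 + 1)), ← expect_add]
  refine expect_congr _ fun a ha => ?_
  rw [automatonStep_of_ne_zero (ne_zero_of_profileProb_ne_zero ha)]

/-- Every realisation in the support leads to the same next state, so `pathValue` solves the Bellman
equation exactly. -/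
lemma payoff_automaton {β : Option (Fin n) → ℕ → MixedProfile A} {i : Fin n} {d : ℝ}
    (h0 : 0 ≤ d) (h1 : d < 1) (h : History A) :
    payoff g (continuation (automaton β) h) i d = pathValue g β i d (automatonState β h) := by
  obtain ⟨B, -, hB⟩ := exists_abs_le g
  have hW : ∀ k, |pathValue g β i d (automatonState β (h ++ k))| ≤ B := fun k =>
    abs_discAvg_le h0 h1 fun t => abs_reward_le hB i _
  have hstep : ∀ k, expect (fun j => continuation (automaton β) h j k) (fun a => (1 - d) * g a i +
      d * pathValue g β i d (automatonState β (h ++ (k ++ [a])))) =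
        pathValue g β i d (automatonState β (h ++ k)) := fun k => by
    simp only [← List.append_assoc, automatonState_append]
    exact expect_step_eq_pathValue h0 h1 _
  have h2 := payoff_le_of_bellman h0 h1 _ hW fun k => (hstep k).le
  have h3 := le_payoff_of_bellman h0 h1 _ hW fun k => (hstep k).ge
  rw [List.append_nil] at h2 h3
  exact le_antisymm h2 h3

variable [∀ i, DecidableEq (A i)]

/-- If all prescribed profiles are myopically indifferent and leaving the support is
unprofitable, then no single deviation is profitable. -/
lemma expect_step_update_le {β : Option (Fin n) → ℕ → MixedProfile A} {i : Fin n} {d : ℝ}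
    (h0 : 0 ≤ d) (h1 : d < 1) {s : Option (Fin n) × ℕ} (hβ : β s.1 s.2 ∈ myopicIndiff g)
    (hdev : ∀ a : A i, (1 - d) * devReward g i a (β s.1 s.2) + d * pathValue g β i d (some i, 0) ≤
      pathValue g β i d s) (μ : MixedAction A i) :
    expect (Function.update (β s.1 s.2) i μ)
      (fun a => (1 - d) * g a i + d * pathValue g β i d (automatonStep β s a)) ≤
        pathValue g β i d s := by
  refine expect_update_le _ i μ _ fun b => ?_
  have hsupp : ∀ x, profileProb (Function.update (β s.1 s.2) i (pureAction b)) x ≠ 0 →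
      x i = b ∧ ∀ j, j ≠ i → (β s.1 s.2 j : A j → ℝ) (x j) ≠ 0 := fun x hx => by
    have hx := ne_zero_of_profileProb_ne_zero hx
    refine ⟨?_, fun j hj => ?_⟩
    · have := hx i
      rw [Function.update_self] at this
      by_contra hne
      exact this (Pi.single_eq_of_ne hne 1)
    · have := hx j
      rwa [Function.update_of_ne hj] at this
  have hconst : ∀ s', (∀ x, profileProb (Function.update (β s.1 s.2) i (pureAction b)) x ≠ 0 →
      automatonStep β s x = s') → expect (Function.update (β s.1 s.2) i (pureAction b))
        (fun a => (1 - d) * g a i + d * pathValue g β i d (automatonStep β s a)) =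
          (1 - d) * devReward g i b (β s.1 s.2) + d * pathValue g β i d s' := fun s' hs' => by
    rw [devReward, reward_eq_expect, ← expect_mul_left,
      ← expect_const (Function.update (β s.1 s.2) i (pureAction b)) (d * pathValue g β i d s'),
      ← expect_add]
    exact expect_congr _ fun a ha => by rw [hs' a ha]
  -- Outside the support `b` starts the punishment of `i`; inside, the path continues and
  -- indifference equates the current rewards.
  by_cases hb : (β s.1 s.2 i : A i → ℝ) b = 0
  · rw [hconst (some i, 0) fun x hx => automatonStep_of_unique_deviator
      (by rw [(hsupp x hx).1, hb]) (hsupp x hx).2]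
    exact hdev b
  · rw [hconst (s.1, s.2 + 1) fun x hx => automatonStep_of_ne_zero fun j => ?_, hβ i b hb,
      ← pathValue_eq h0 h1]
    by_cases hj : j = i
    · subst hj; rwa [(hsupp x hx).1]
    · exact (hsupp x hx).2 j hj

/-- One-shot deviation principle: `pathValue` is a Bellman supersolution against any strategy of
`i`, from any history. -/
lemma isSPNE_automaton {β : Option (Fin n) → ℕ → MixedProfile A} {δ : Fin n → ℝ}
    (hδ : ∀ i, δ i ∈ Ico (0 : ℝ) 1) (hβ : ∀ p t, β p t ∈ myopicIndiff g)
    (hdev : ∀ i p t a, (1 - δ i) * devReward g i a (β p t) +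
      δ i * pathValue g β i (δ i) (some i, 0) ≤ pathValue g β i (δ i) (p, t)) :
    IsSPNE g δ (automaton β) := by
  intro h i τ
  obtain ⟨B, -, hB⟩ := exists_abs_le g
  rw [payoff_automaton (hδ i).1 (hδ i).2]
  have := payoff_le_of_bellman (g := g) (i := i)
    (σ := Function.update (continuation (automaton β) h) i τ) (hδ i).1 (hδ i).2
    (fun k => pathValue g β i (δ i) (automatonState β (h ++ k))) (B := B)
    (fun k => abs_discAvg_le (hδ i).1 (hδ i).2 fun t => abs_reward_le hB i _) fun k => by
      simp only [← List.append_assoc, automatonState_append]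
      have e : (fun j => Function.update (continuation (automaton β) h) i τ j k) =
          Function.update (β (automatonState β (h ++ k)).1 (automatonState β (h ++ k)).2) i
            (τ k) := by
        funext j
        by_cases hj : j = i
        · subst hj; simp
        · simp [hj, continuation, automaton]
      rw [e]
      exact expect_step_update_le (hδ i).1 (hδ i).2 (hβ _ _) (fun a => hdev i _ _ a) _
  simpa using this

/-! ### The construction -/

/-- The pure profile `a` as a mixed profile. -/
noncomputable def pureProfile (a : Profile A) : MixedProfile A := fun i => pureAction (a i)

lemma reward_pureProfile (a : Profile A) (i : Fin n) : reward g i (pureProfile a) = g a i := by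
  rw [reward_eq_expect, ← expect_const (pureProfile a) (g a i)]
  refine expect_congr _ fun b hb => ?_
  have : b = a := by
    funext j
    by_contra hne
    exact ne_zero_of_profileProb_ne_zero hb j (Pi.single_eq_of_ne hne 1)
  rw [this]

lemma pureProfile_mem_myopicIndiff (a : Profile A) : pureProfile a ∈ myopicIndiff g := by
  intro i b hb
  have : b = a i := by
    by_contra hne
    exact hb (Pi.single_eq_of_ne hne 1)
  subst this
  rw [devReward]
  congr 1
  exact Function.update_eq_self i (pureProfile a)

lemma reward_le_of_devReward_le {α : MixedProfile A} {i : Fin n} {c : ℝ}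
    (h : ∀ a, devReward g i a α ≤ c) : reward g i α ≤ c := by
  have := expect_update_le α i (α i) (fun a => g a i) h
  rwa [Function.update_eq_self] at this

lemma exists_devReward_le_of_miMinmax_lt [∀ i, Nonempty (A i)] {i : Fin n} {x : ℝ}
    (hx : miMinmax g i < x) : ∃ α ∈ myopicIndiff g, ∃ c < x, ∀ a, devReward g i a α ≤ c := by
  have hne : ((fun α : MixedProfile A => ⨆ a : A i, devReward g i a α) ''
      myopicIndiff g).Nonempty :=
    ⟨_, pureProfile fun i => Classical.arbitrary (A i), pureProfile_mem_myopicIndiff _, rfl⟩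
  obtain ⟨_, ⟨α, hα, rfl⟩, hlt⟩ := exists_lt_of_csInf_lt hne hx
  exact ⟨α, hα, _, hlt, fun a => le_ciSup (f := fun a : A i => devReward g i a α)
    (Set.finite_range _).bddAbove a⟩

theorem isLimitBlackwellPayoff_of_mem_feasibleMI [∀ i, Nonempty (A i)]
    (hdim : dimension (feasible g) = n) {v : Fin n → ℝ} (hv : v ∈ feasibleMI g) :
    IsLimitBlackwellPayoff g v := by
  obtain ⟨hvF, hvm⟩ := hv
  choose α hα c hcv hαc using fun i => exists_devReward_le_of_miMinmax_lt (hvm i)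
  have hpc : ∀ i, reward g i (α i) ≤ c i := fun i => reward_le_of_devReward_le (hαc i)
  have hlow : ∀ j, ∃ a, g a j < v j := fun j => by
    by_contra hcon
    push Not at hcon
    have := expect_mono (α j) hcon
    rw [expect_const, ← reward_eq_expect] at this
    linarith [hpc j, hcv j]
  obtain ⟨w, hw⟩ := exists_punishment_payoffs hdim hvF hcv hlow
  obtain ⟨B, hB0, hB⟩ := exists_abs_le g
  obtain ⟨b₀, C₀, hb₀⟩ := exists_seq_of_mem_feasible hvF
  choose b K hb using fun j => exists_seq_of_mem_feasible (hw j).1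
  -- No circularity: `K i` concerns only the sequence after the block, whereas the bound `C` for
  -- whole paths, which depends on `N`, is chosen later.
  have hN : ∀ i, ∃ N : ℕ, B + 4 * K i - w i i < N * (w i i - reward g i (α i)) := fun i => by
    have hpos : 0 < w i i - reward g i (α i) := by linarith [hpc i, (hw i).2.1]
    obtain ⟨N, hN⟩ := exists_nat_gt ((B + 4 * K i - w i i) / (w i i - reward g i (α i)))
    exact ⟨N, (div_lt_iff₀ hpos).1 hN⟩
  choose N hN using hN
  let β : Option (Fin n) → ℕ → MixedProfile A
    | none, t => pureProfile (b₀ t)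
    | some i, t => if t < N i then α i else pureProfile (b i (t - N i))
  let m : Option (Fin n) → Fin n → ℝ
    | none => v
    | some i => w i
  have hβ : ∀ p t, β p t ∈ myopicIndiff g := by
    rintro (_ | i) t
    · exact pureProfile_mem_myopicIndiff _
    · simp only [β]
      split_ifs
      · exact hα i
      · exact pureProfile_mem_myopicIndiff _
  have htail : ∀ j i T,
      |∑ t ∈ Finset.range T, (reward g i (β (some j) (N j + t)) - w j i)| ≤ K j := by
    intro j i T
    simpa [β, reward_pureProfile] using hb j i T
  have hdisc : ∀ i, ∃ C, ∀ p T,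
      |∑ t ∈ Finset.range T, (reward g i (β p t) - m p i)| ≤ C := by
    intro i
    have : ∀ p, ∃ C, ∀ T, |∑ t ∈ Finset.range T, (reward g i (β p t) - m p i)| ≤ C := by
      rintro (_ | j)
      · exact ⟨C₀, fun T => by simpa [β, m, reward_pureProfile] using hb₀ i T⟩
      · exact ⟨_, abs_partialSum_le_of_tail (B := B + |w j i|) (N j) (by positivity)
          (fun t => (abs_sub _ _).trans (add_le_add (abs_reward_le hB i _) le_rfl))
          (htail j i)⟩
    choose C hC using this
    obtain ⟨D, hD⟩ := (Set.finite_range C).bddAbove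
    exact ⟨D, fun p T => (hC p T).trans (hD (mem_range_self p))⟩
  choose C hC using hdisc
  -- The incentives of `i` involve only the discount factor of `i`, so a scalar threshold covers all
  -- vectors of discount factors.
  have hev : ∀ᶠ d in 𝓝[<] (1 : ℝ), ∀ i p t a, (1 - d) * devReward g i a (β p t) +
      d * pathValue g β i d (some i, 0) ≤ pathValue g β i d (p, t) := by
    refine eventually_all.2 fun i => ?_
    have := eventually_deviation_le (r := fun p t => reward g i (β p t)) (m := fun p => m p i)
      (q := some i) (B := B) (C := C i) (K := K i) (p := reward g i (α i)) (c := c i) (N := N i)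
      (fun p t => abs_reward_le hB i _) (hC i) (htail i i) (by
        rintro (_ | j) hj
        · exact (hw i).2.2.1
        · exact (hw i).2.2.2 j fun h => hj (by rw [h]))
      (fun t ht => by simp [β, ht]) (hpc i) (hw i).2.1 (hN i)
    filter_upwards [this] with d hd p t a
    refine hd p t _ (abs_reward_le hB i _) ?_
    rintro rfl ht
    simp only [β, if_pos ht]
    exact hαc i a
  obtain ⟨d₁, hd₁, hd₁'⟩ := (mem_nhdsLT_iff_exists_Ico_subset (a := (1 : ℝ))).1 hev
  refine ⟨automaton β, ⟨max d₁ 0, ⟨le_max_right _ _, max_lt hd₁ one_pos⟩, fun δ hδ => ?_⟩, ?_⟩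
  · exact isSPNE_automaton (fun i => ⟨(le_max_right _ _).trans (hδ i).1, (hδ i).2⟩) hβ
      fun i p t a => hd₁' ⟨(le_max_left _ _).trans (hδ i).1, (hδ i).2⟩ i p t a
  · rw [tendsto_pi_nhds]
    intro i
    have hlim : Tendsto (fun δ : Fin n → ℝ => 2 * C i * (1 - δ i))
        (𝓝[{δ | ∀ i, δ i ∈ Ico (0 : ℝ) 1}] (fun _ => 1)) (𝓝 0) := by
      have : Continuous fun δ : Fin n → ℝ => 2 * C i * (1 - δ i) := by fun_prop
      simpa using (this.tendsto fun _ => 1).mono_left nhdsWithin_le_nhds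
    rw [tendsto_iff_norm_sub_tendsto_zero]
    refine squeeze_zero' (Eventually.of_forall fun _ => norm_nonneg _) ?_ hlim
    filter_upwards [self_mem_nhdsWithin] with δ hδ
    have := payoff_automaton (g := g) (β := β) (i := i) (hδ i).1 (hδ i).2 []
    rw [continuation_nil] at this
    rw [payoffVector, this, Real.norm_eq_abs]
    exact abs_discAvg_tail_sub_le (hδ i).1 (hδ i).2 (x := fun t => reward g i (β none t))
      (fun t => abs_reward_le hB i _) (hC i none) 0

end Automaton

end RepeatedGame

theorem theorem5 {n : ℕ} {A : Fin n → Type*} [∀ i, Fintype (A i)] [∀ i, Nonempty (A i)]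
    [∀ i, DecidableEq (A i)] (g : (∀ i, A i) → Fin n → ℝ)
    (hdim : RepeatedGame.dimension (RepeatedGame.feasible g) = n) :
    (∀ v : Fin n → ℝ, v ∈ RepeatedGame.feasibleMI g → RepeatedGame.IsLimitBlackwellPayoff g v) ∧
    ((RepeatedGame.feasibleMI g).Nonempty →
      ∀ v : Fin n → ℝ, RepeatedGame.IsLimitBlackwellPayoff g v →
        v ∈ closure (RepeatedGame.feasibleMI g)) :=
  ⟨fun _ hv => RepeatedGame.isLimitBlackwellPayoff_of_mem_feasibleMI hdim hv,
    fun hne _ hv => RepeatedGame.mem_closure_feasibleMI hne hv.mem_feasible_and_le.1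
      hv.mem_feasible_and_le.2⟩
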